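/- Let $X$ be a convex subset of a real normed vector space, let $H$ be a real normed vector space (for example a separable Hilbert space), and let $X^*$ be the set of nonempty finite subsets of $X$. Let $f:X^*\to H$, and write $f(x)=f(\{x\})$. Suppose that (a) (weighted averaging) for all disjoint $A,B\in X^*$ there is $\lambda\in[0,1]$ with $f(A\cup B)=\lambda f(A)+(1-\lambda)f(B)$; (b) (strong richness) for every $x\in X$ there are $y,z\in X$ such that $f(x),f(y),f(z)$ do not lie on a common line, $f(\{x,y\})\notin\{f(x),f(y)\}$ and $f(\{x,z\})\notin\{f(x),f(z)\}$; (c) (continuity) for every $A\in X^*\cup\{\emptyset\}$, every $x\in X\setminus A$ and every sequence $x_n\to x$ in $X$, $f(A\cup\{x_n\})\to f(A\cup\{x\})$. Then there is a continuous function $w:X\to(0,\infty)$ such that for every $A\in X^*$ $$f(A)=\frac{\sum_{x\in A}w(x)f(x)}{\sum_{x\in A}w(x)}.$$ Moreover, whenever $\succcurlyeq$ is a weak order (a reflexive, transitive and complete relation) on $X$ and $v:X\to(0,\infty)$ is a function such that, for every $A\in X^*$, $f(A)$ is the $v$-weighted average of the values $f(x)$ over the $\succcurlyeq$-highest elements $x$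 of $A$, the order $\succcurlyeq$ has a single equivalence class, that is, $x\succcurlyeq y$ for all $x,y\in X$. -/

import Mathlib

open Filter Topology

/-- The set `X^*` of all nonempty finite subsets of `α`. -/
abbrev NonemptyFinset (α : Type*) : Type _ := {A : Finset α // A.Nonempty}

namespace NonemptyFinset

variable {α : Type*}

/-- The singleton `{x}`. -/
def single (x : α) : NonemptyFinset α := ⟨{x}, Finset.singleton_nonempty x⟩

open Classical in
/-- The union of two nonempty finite sets. -/
noncomputable def union (A B : NonemptyFinset α) : NonemptyFinset α :=
  ⟨A.1 ∪ B.1, A.2.mono Finset.subset_union_left⟩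

open Classical in
/-- The set `A ∪ {x}`, where the finite set `A` may be empty. -/
noncomputable def insertPoint (A : Finset α) (x : α) : NonemptyFinset α :=
  ⟨insert x A, Finset.insert_nonempty x A⟩

/-- The pair `{x, y}`. -/
noncomputable def pair (x y : α) : NonemptyFinset α := union (single x) (single y)

end NonemptyFinset

/-- An aggregation rule on `α` with values in `H`. -/
abbrev AggregationRule (α H : Type*) : Type _ := NonemptyFinset α → H

namespace AggregationRule

open NonemptyFinset

variable {α H : Type*}

/-- The output `f(x) = f({x})` of a single model. -/
def value (f : AggregationRule α H) (x : α) : H := f (single x)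

/-- The weighted averaging property. -/
def WeightedAveraging [AddCommGroup H] [Module ℝ H] (f : AggregationRule α H) : Prop :=
  ∀ A B : NonemptyFinset α, Disjoint A.1 B.1 →
    ∃ t : ℝ, 0 ≤ t ∧ t ≤ 1 ∧ f (union A B) = t • f A + (1 - t) • f B

/-- Strong richness: every `x` has `y`, `z` such that the three outputs are not on one line and
the aggregations of `{x, y}` and of `{x, z}` are not extreme. -/
def StronglyRich [AddCommGroup H] [Module ℝ H] (f : AggregationRule α H) : Prop :=
  ∀ x : α, ∃ y z : α,
    ¬ Collinear ℝ {f.value x, f.value y, f.value z} ∧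
    (f (pair x y) ≠ f.value x ∧ f (pair x y) ≠ f.value y) ∧
    (f (pair x z) ≠ f.value x ∧ f (pair x z) ≠ f.value z)

/-- Continuity of an aggregation rule: replacing `x` by a nearby model in `A ∪ {x}`, where `A` is
a possibly empty finite set not containing `x`. -/
def ContinuousRule [TopologicalSpace α] [TopologicalSpace H] (f : AggregationRule α H) : Prop :=
  ∀ (A : Finset α) (x : α), x ∉ A → ∀ u : ℕ → α, Tendsto u atTop (𝓝 x) →
    Tendsto (fun n => f (insertPoint A (u n))) atTop (𝓝 (f (insertPoint A x)))

/-- A weak order: a reflexive, transitive and complete relation; `r x y` means `x ≽ y`. -/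
structure IsWeakOrder (r : α → α → Prop) : Prop where
  refl : ∀ x, r x x
  trans : ∀ x y z, r x y → r y z → r x z
  complete : ∀ x y, r x y ∨ r y x

open Classical in
/-- The highest-ordered elements `M(A, ≽)` of a finite set `A`. -/
noncomputable def highest (r : α → α → Prop) (A : Finset α) : Finset α :=
  A.filter (fun x => ∀ y ∈ A, r x y)

/-- The weighted average over `B` of the outputs of the single models in `B`. -/
noncomputable def average [AddCommGroup H] [Module ℝ H] (f : AggregationRule α H) (w : α → ℝ)
    (B : Finset α) : H :=
  ∑ x ∈ B, (w x / ∑ y ∈ B, w y) • f.value x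

/-- `f` is represented by the weak order `r` and the strictly positive weight `w`. -/
def RepresentedBy [AddCommGroup H] [Module ℝ H] (f : AggregationRule α H)
    (r : α → α → Prop) (w : α → ℝ) : Prop :=
  IsWeakOrder r ∧ (∀ x, 0 < w x) ∧ ∀ A : NonemptyFinset α, f A = average f w (highest r A.1)

end AggregationRule

/-! ### Center masses and the passage from pairs to finite sets. -/

section CenterMass

variable {α H : Type*} [AddCommGroup H] [Module ℝ H]

/-! A nondegenerate pair determines a ratio ρ, which must be `w y / w x`. Computing `f` on a triple
by splitting off each point in turn shows that ratios multiply when the three outputs are not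
collinear; richness supplies detours off any line, so they multiply whenever the end outputs differ.
Nearby points share a partner, hence connectedness of `X` joins any two points by a chain of
balanced pairs. Weights are products along chains from a base point. `eq_centerMass_of_pairs`
extends the formula from pairs to finite sets, and continuity of `w` follows by writing ratios as
quotients of norms. Any representing order relates balanced pairs both ways, so chains make it
trivial. -/

theorem exists_eq_add_smul_sub {a b p q : H} {t s : ℝ} (hp : p = t • a + (1 - t) • b)
    (hq : q = s • a + (1 - s) • b) (hpq : p ≠ q) :
    (∃ r : ℝ, a = p + r • (q - p)) ∧ ∃ r : ℝ, b = p + r • (q - p) := by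
  have hts : s - t ≠ 0 := by
    intro h
    obtain rfl : s = t := by linarith
    exact hpq (hp.trans hq.symm)
  subst hp hq
  refine ⟨⟨(1 - t) / (s - t), ?_⟩, ⟨-t / (s - t), ?_⟩⟩
  · match_scalars <;> field_simp <;> ring
  · match_scalars <;> field_simp <;> ring

theorem coeff_eq_zero_of_not_collinear {a b c : H} (h : ¬ Collinear ℝ {a, b, c}) {r s t : ℝ}
    (hsum : r + s + t = 0) (hcomb : r • a + s • b + t • c = 0) : r = 0 ∧ s = 0 ∧ t = 0 := by
  have hind := affineIndependent_iff_not_collinear_set.2 h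
  rw [affineIndependent_iff] at hind
  have key := hind Finset.univ ![r, s, t] (by simpa [Fin.sum_univ_three] using hsum)
    (by simpa [Fin.sum_univ_three] using hcomb)
  exact ⟨by simpa using key 0, by simpa using key 1, by simpa using key 2⟩

/-- Some point of `t` is off the line carrying `s`; a functional killing the line's direction
separates it. -/
theorem exists_linearMap_eq_const_of_collinear {s : Set H} (hs : Collinear ℝ s) {t : Set H}
    (ht : ¬ Collinear ℝ t) :
    ∃ (φ : H →ₗ[ℝ] ℝ) (c : ℝ), (∀ p ∈ s, φ p = c) ∧ ∃ z ∈ t, φ z ≠ c := by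
  obtain ⟨p₀, d, hd⟩ := (collinear_iff_exists_forall_eq_smul_vadd s).1 hs
  have hz : ∃ z ∈ t, z - p₀ ∉ Submodule.span ℝ {d} := by
    by_contra! hcon
    refine ht ((collinear_iff_exists_forall_eq_smul_vadd t).2 ⟨p₀, d, fun z hz => ?_⟩)
    obtain ⟨r, hr⟩ := Submodule.mem_span_singleton.1 (hcon z hz)
    exact ⟨r, by simp [hr]⟩
  obtain ⟨z, hzt, hz⟩ := hz
  obtain ⟨φ, hφz, hφ⟩ := Submodule.exists_le_ker_of_notMem hz
  have hφd : φ d = 0 := hφ (Submodule.mem_span_singleton_self d)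
  refine ⟨φ, φ p₀, fun p hp => ?_, z, hzt, fun h => hφz (by rw [map_sub, h, sub_self])⟩
  obtain ⟨r, rfl⟩ := hd p hp
  simp [hφd]

theorem centerMass_map_eq_const {A : Finset α} (hA : A.Nonempty) {w : α → ℝ} (hw : ∀ x, 0 < w x)
    {z : α → H} {φ : H →ₗ[ℝ] ℝ} {c : ℝ} (h : ∀ x ∈ A, φ (z x) = c) :
    φ (A.centerMass w z) = c := by
  have hW : ∑ x ∈ A, w x ≠ 0 := (Finset.sum_pos (fun x _ => hw x) hA).ne'
  have hsum : ∑ x ∈ A, φ (w x • z x) = ∑ x ∈ A, w x * c :=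
    Finset.sum_congr rfl fun x hx => by rw [map_smul, h x hx, smul_eq_mul]
  rw [Finset.centerMass, map_smul, map_sum, hsum, ← Finset.sum_mul, smul_eq_mul,
    inv_mul_cancel_left₀ hW]

theorem centerMass_union [DecidableEq α] {A B : Finset α} (hA : A.Nonempty) (hB : B.Nonempty)
    (hAB : Disjoint A B) {w : α → ℝ} (hw : ∀ x, 0 < w x) (z : α → H) :
    ∃ t : ℝ, 0 < t ∧ t < 1 ∧
      (A ∪ B).centerMass w z = t • A.centerMass w z + (1 - t) • B.centerMass w z := by
  have hWA : 0 < ∑ x ∈ A, w x := Finset.sum_pos (fun x _ => hw x) hA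
  have hWB : 0 < ∑ x ∈ B, w x := Finset.sum_pos (fun x _ => hw x) hB
  simp only [Finset.centerMass, Finset.sum_union hAB]
  generalize ∑ x ∈ A, w x = a at *
  generalize ∑ x ∈ B, w x = b at *
  refine ⟨a / (a + b), by positivity, by rw [div_lt_one (by positivity)]; linarith, ?_⟩
  match_scalars <;> field_simp
  ring

/-- If all the center masses of `A` with one point removed agree, then `A` is constant. -/
theorem eq_of_centerMass_erase_eq [DecidableEq α] {A : Finset α} (hA : 2 ≤ A.card) {w : α → ℝ}
    (hw : ∀ x, 0 < w x) {z : α → H} {p : H} (h : ∀ x ∈ A, (A.erase x).centerMass w z = p) :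
    ∀ x ∈ A, z x = p := by
  set S := ∑ x ∈ A, w x • z x with hS
  set W := ∑ x ∈ A, w x with hW
  -- The weighted deviation from `p` is the same for every point, and the deviations sum to that
  -- same vector; with at least two points it vanishes.
  have key : ∀ x ∈ A, w x • (z x - p) = S - W • p := by
    intro x hx
    have hne : (A.erase x).Nonempty := by
      rw [← Finset.card_pos, Finset.card_erase_of_mem hx]; omega
    have hpos : ∑ y ∈ A.erase x, w y ≠ 0 := (Finset.sum_pos (fun y _ => hw y) hne).ne'
    have h1 := h x hx
    rw [Finset.centerMass, inv_smul_eq_iff₀ hpos] at h1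
    have h2 : S = w x • z x + ∑ y ∈ A.erase x, w y • z y :=
      (Finset.add_sum_erase A (fun y => w y • z y) hx).symm
    have h3 : W = w x + ∑ y ∈ A.erase x, w y := (Finset.add_sum_erase A w hx).symm
    rw [h2, h3, h1]
    module
  have hsum : S - W • p = (A.card : ℝ) • (S - W • p) := by
    calc S - W • p = ∑ x ∈ A, w x • (z x - p) := by
          simp only [smul_sub, Finset.sum_sub_distrib, ← Finset.sum_smul, hS, hW]
      _ = ∑ _x ∈ A, (S - W • p) := Finset.sum_congr rfl key
      _ = _ := by rw [Finset.sum_const, Nat.cast_smul_eq_nsmul]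
  have hzero : S - W • p = 0 := by
    have h1 : ((A.card : ℝ) - 1) • (S - W • p) = 0 := by
      rw [sub_smul, one_smul, ← hsum, sub_self]
    refine (smul_eq_zero.1 h1).resolve_left ?_
    have : (2 : ℝ) ≤ A.card := by exact_mod_cast hA
    linarith
  intro x hx
  have h1 := key x hx
  rw [hzero] at h1
  exact sub_eq_zero.1 ((smul_eq_zero.1 h1).resolve_left (hw x).ne')

/-- A function of finite sets with the averaging property that is a weighted average on pairs and
whose values on singletons are not collinear is a weighted average on all finite sets. -/
theorem eq_centerMass_of_pairs [DecidableEq α] {F : Finset α → H} {w : α → ℝ}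
    (hw : ∀ x, 0 < w x)
    (hF : ∀ A B : Finset α, A.Nonempty → B.Nonempty → Disjoint A B →
      ∃ t : ℝ, F (A ∪ B) = t • F A + (1 - t) • F B)
    (hpair : ∀ x y, x ≠ y → F {x, y} = ({x, y} : Finset α).centerMass w fun a => F {a})
    (hdim : ¬ Collinear ℝ (Set.range fun a => F {a})) (A : Finset α) (hA : A.Nonempty) :
    F A = A.centerMass w fun a => F {a} := by
  induction A using Finset.strongInduction with
  | H A ih =>
  set g : Finset α → H := fun B => B.centerMass w fun a => F {a} with hg
  have hsingle : ∀ x, g {x} = F {x} := fun x => Finset.centerMass_singleton _ _ (hw x).ne'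
  change F A = g A
  by_cases hcard : A.card = 1
  · obtain ⟨x, rfl⟩ := Finset.card_eq_one.1 hcard
    exact (hsingle x).symm
  have hcard2 : 2 ≤ A.card := by have := hA.card_pos; omega
  have herase : ∀ x ∈ A, (A.erase x).Nonempty := fun x hx => by
    rw [← Finset.card_pos, Finset.card_erase_of_mem hx]; omega
  have hunion : ∀ x ∈ A, {x} ∪ A.erase x = A := fun x hx => by
    rw [← Finset.insert_eq, Finset.insert_erase hx]
  have hFe : ∀ x ∈ A, F (A.erase x) = g (A.erase x) := fun x hx =>
    ih _ (Finset.erase_ssubset hx) (herase x hx)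
  have hFA : ∀ x ∈ A, ∃ t : ℝ, F A = t • F {x} + (1 - t) • g (A.erase x) := by
    intro x hx
    have := hF {x} (A.erase x) (by simp) (herase x hx) (by simp)
    rwa [hunion x hx, hFe x hx] at this
  have hgA : ∀ x ∈ A, ∃ t : ℝ, g A = t • F {x} + (1 - t) • g (A.erase x) := by
    intro x hx
    obtain ⟨t, -, -, ht⟩ := centerMass_union (A := {x}) (B := A.erase x) (by simp) (herase x hx)
      (by simp) hw (fun a => F {a})
    rw [hunion x hx] at ht
    exact ⟨t, by rw [← hsingle x]; exact ht⟩
  by_cases hcol : Collinear ℝ ((fun a => F {a}) '' (A : Set α))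
  swap
  -- Were `F A ≠ g A`, every `F {x}` would lie on the line through them.
  · by_contra hne
    apply hcol
    rw [collinear_iff_exists_forall_eq_smul_vadd]
    refine ⟨F A, g A - F A, ?_⟩
    rintro _ ⟨x, hx, rfl⟩
    obtain ⟨t, ht⟩ := hFA x hx
    obtain ⟨s, hs⟩ := hgA x hx
    obtain ⟨r, hr⟩ := (exists_eq_add_smul_sub ht hs hne).1
    exact ⟨r, by rw [vadd_eq_add, add_comm]; exact hr⟩
  obtain ⟨x₀, hx₀⟩ := hA
  by_cases hconst : ∀ x ∈ A, F {x} = F {x₀}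
  · have hge : g (A.erase x₀) = F {x₀} := by
      have hWe : ∑ x ∈ A.erase x₀, w x ≠ 0 :=
        (Finset.sum_pos (fun y _ => hw y) (herase x₀ hx₀)).ne'
      have hsum : ∑ x ∈ A.erase x₀, w x • F {x} = ∑ x ∈ A.erase x₀, w x • F {x₀} :=
        Finset.sum_congr rfl fun x hx => by rw [hconst x (Finset.mem_of_mem_erase hx)]
      simp only [hg, Finset.centerMass]
      rw [hsum, ← Finset.sum_smul, inv_smul_smul₀ hWe]
    obtain ⟨t, ht⟩ := hFA x₀ hx₀
    obtain ⟨s, hs⟩ := hgA x₀ hx₀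
    rw [ht, hs, hge]
    module
  -- The outputs on `A` are collinear but not constant: adjoin a point `z` off their line and
  -- compare `F` with `g` on the larger set.
  obtain ⟨φ, c, hφA, _, ⟨z, rfl⟩, hz⟩ := exists_linearMap_eq_const_of_collinear hcol hdim
  replace hz : φ (F {z}) ≠ c := hz
  replace hφA : ∀ x ∈ A, φ (F {x}) = c := fun x hx => hφA _ ⟨x, hx, rfl⟩
  have hzA : z ∉ A := fun h => hz (hφA z h)
  have hφe : ∀ x ∈ A, φ (g (A.erase x)) = c := fun x hx =>
    centerMass_map_eq_const (herase x hx) hw fun y hy => hφA y (Finset.mem_of_mem_erase hy)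
  have hφg : φ (g A) = c := centerMass_map_eq_const ⟨x₀, hx₀⟩ hw hφA
  have hφF : φ (F A) = c := by
    obtain ⟨t, ht⟩ := hFA x₀ hx₀
    rw [ht, map_add, map_smul, map_smul, hφA x₀ hx₀, hφe x₀ hx₀, smul_eq_mul, smul_eq_mul]
    ring
  have hB : F ({z} ∪ A) = g ({z} ∪ A) := by
    by_contra hne
    set P := F ({z} ∪ A) with hP
    set D := g ({z} ∪ A) - P with hD
    -- `F` and `g` agree on both blocks `{z, x}` and `A.erase x`, so if they differ on the union,
    -- their two values span a line containing both block values.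
    have hline : ∀ x ∈ A, (∃ r : ℝ, F {z, x} = P + r • D) ∧ ∃ r : ℝ, g (A.erase x) = P + r • D := by
      intro x hx
      have hzx : z ≠ x := fun h => hzA (h ▸ hx)
      have hdisj : Disjoint {z, x} (A.erase x) := by simp [hzA]
      have hun : {z, x} ∪ A.erase x = {z} ∪ A := by
        conv_rhs => rw [← hunion x hx]
        rw [← Finset.union_assoc, ← Finset.insert_eq]
      obtain ⟨t, ht⟩ := hF {z, x} (A.erase x) (by simp) (herase x hx) hdisj
      obtain ⟨s, -, -, hs⟩ := centerMass_union (A := {z, x}) (by simp) (herase x hx) hdisj hw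
        (fun a => F {a})
      rw [hun, hFe x hx] at ht
      rw [hun, ← hpair z x hzx] at hs
      exact exists_eq_add_smul_sub ht hs hne
    obtain ⟨r₀, hr₀⟩ := (hline x₀ hx₀).2
    -- Otherwise `φ = c` on the whole line, yet `F {z, x₀}` gives `z` positive weight.
    have hφD : φ D ≠ 0 := by
      intro h0
      obtain ⟨s, hs⟩ := (hline x₀ hx₀).1
      have hzx : z ≠ x₀ := fun h => hzA (h ▸ hx₀)
      obtain ⟨t, ht0, -, ht⟩ := centerMass_union (A := {z}) (B := {x₀}) (by simp) (by simp)
        (by simpa using hzx) hw (fun a => F {a})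
      rw [← Finset.insert_eq, ← hpair z x₀ hzx] at ht
      change F {z, x₀} = t • g {z} + (1 - t) • g {x₀} at ht
      rw [hsingle, hsingle] at ht
      have h1 := congrArg φ (ht.symm.trans hs)
      have h2 := congrArg φ hr₀
      simp only [map_add, map_smul, smul_eq_mul, h0, hφA x₀ hx₀, hφe x₀ hx₀, mul_zero,
        add_zero] at h1 h2
      apply hz
      have h3 : t * (φ (F {z}) - c) = 0 := by linear_combination h1 - h2
      exact sub_eq_zero.1 ((mul_eq_zero.1 h3).resolve_left ht0.ne')
    -- The line meets the level set `φ = c` only once, so all the `g (A.erase x)` coincide.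
    have hall : ∀ x ∈ A, F {x} = g (A.erase x₀) := by
      refine eq_of_centerMass_erase_eq hcard2 hw fun x hx => ?_
      change g (A.erase x) = g (A.erase x₀)
      obtain ⟨r, hr⟩ := (hline x hx).2
      have h1 := congrArg φ hr
      have h2 := congrArg φ hr₀
      simp only [map_add, map_smul, smul_eq_mul, hφe x hx, hφe x₀ hx₀] at h1 h2
      have h3 : r = r₀ := mul_right_cancel₀ hφD (by linarith)
      rw [hr, hr₀, h3]
    exact hconst fun x hx => (hall x hx).trans (hall x₀ hx₀).symm
  obtain ⟨t, ht⟩ := hF {z} A (by simp) ⟨x₀, hx₀⟩ (by simpa using hzA)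
  obtain ⟨s, -, hs1, hs⟩ := centerMass_union (A := {z}) (B := A) (by simp) ⟨x₀, hx₀⟩
    (by simpa using hzA) hw (fun a => F {a})
  change g ({z} ∪ A) = s • g {z} + (1 - s) • g A at hs
  rw [hsingle] at hs
  have heq := ht.symm.trans (hB.trans hs)
  -- `φ` identifies the two coefficients of `z`; the remaining coefficient `1 - s` is nonzero and
  -- cancels.
  have h1 := congrArg φ heq
  simp only [map_add, map_smul, smul_eq_mul, hφF, hφg] at h1
  have hts : t = s := mul_right_cancel₀ (sub_ne_zero.2 hz) (by linear_combination h1)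
  rw [hts] at heq
  exact smul_right_injective H (sub_ne_zero.2 hs1.ne') (add_left_cancel heq)

end CenterMass

namespace AggregationRule

open NonemptyFinset

/-! ### Ratios of balanced pairs and chains. -/

section Balance

variable {α H : Type*} [AddCommGroup H] [Module ℝ H] {f : AggregationRule α H}

theorem _root_.NonemptyFinset.pair_comm (x y : α) : pair x y = pair y x := by
  classical
  apply Subtype.ext
  simp only [pair, union, single]
  exact Finset.union_comm _ _

/-- The outputs of `x` and `y` differ, and `{x, y}` is aggregated with weights `1 : ρ`. -/
def BalancedBy (f : AggregationRule α H) (x y : α) (ρ : ℝ) : Prop :=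
  0 < ρ ∧ f.value x ≠ f.value y ∧ (1 + ρ) • f (pair x y) = f.value x + ρ • f.value y

namespace BalancedBy

variable {x y z u v : α} {ρ σ τ : ℝ}

theorem pos (h : f.BalancedBy x y ρ) : 0 < ρ := h.1

theorem value_ne (h : f.BalancedBy x y ρ) : f.value x ≠ f.value y := h.2.1

theorem symm (h : f.BalancedBy x y ρ) : f.BalancedBy y x ρ⁻¹ := by
  obtain ⟨hρ, hne, heq⟩ := h
  refine ⟨inv_pos.2 hρ, hne.symm, ?_⟩
  have h1 : (1 + ρ⁻¹) = ρ⁻¹ * (1 + ρ) := by field_simp; ring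
  rw [pair_comm, h1, mul_smul, heq, smul_add, inv_smul_smul₀ hρ.ne', add_comm]

theorem pair_eq (h : f.BalancedBy x y ρ) :
    f (pair x y) = (1 + ρ)⁻¹ • (f.value x + ρ • f.value y) := by
  have := h.pos
  rw [← h.2.2, inv_smul_smul₀ (by positivity)]

theorem pair_ne_left (h : f.BalancedBy x y ρ) : f (pair x y) ≠ f.value x := by
  intro h'
  obtain ⟨hρ, hne, heq⟩ := h
  rw [h', add_smul, one_smul] at heq
  exact hne (smul_right_injective H hρ.ne' (add_left_cancel heq))

theorem pair_ne_right (h : f.BalancedBy x y ρ) : f (pair x y) ≠ f.value y := by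
  rw [pair_comm]
  exact h.symm.pair_ne_left

/-- Three splittings of `f {x, y, z}` must have the same barycentric coordinates, which forces the
ratio on `{x, z}`. -/
theorem trans_of_not_collinear (hwa : f.WeightedAveraging) (hxy : f.BalancedBy x y ρ)
    (hyz : f.BalancedBy y z σ) (hcol : ¬ Collinear ℝ {f.value x, f.value y, f.value z}) :
    f.BalancedBy x z (ρ * σ) := by
  classical
  have hvxz : f.value x ≠ f.value z := by
    intro h
    apply hcol
    rw [h, Set.insert_comm, Set.pair_eq_singleton]
    exact collinear_pair ℝ _ _
  have hne {a b : α} (h : f.value a ≠ f.value b) : a ≠ b := fun h' => h (h' ▸ rfl)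
  have nxz := hne hvxz
  have nxy := hne hxy.value_ne
  have nyz := hne hyz.value_ne
  obtain ⟨t, -, -, ht⟩ := hwa (pair x y) (single z) (by simp [pair, union, single, nxz.symm, nyz.symm])
  obtain ⟨s, -, -, hs⟩ := hwa (single x) (pair y z)
    (by simp [pair, union, single, nxz, nxy])
  obtain ⟨u, -, -, hu⟩ := hwa (pair x z) (single y)
    (by simp [pair, union, single, nxy.symm, nyz])
  obtain ⟨γ, -, -, hγ⟩ := hwa (single x) (single z) (by simp [single, nxz])
  have e1 : union (single x) (pair y z) = union (pair x y) (single z) := by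
    apply Subtype.ext; ext a; simp [pair, union, single]; tauto
  have e2 : union (pair x z) (single y) = union (pair x y) (single z) := by
    apply Subtype.ext; ext a; simp [pair, union, single]; tauto
  change f (pair x z) = γ • f.value x + (1 - γ) • f.value z at hγ
  unfold BalancedBy
  rw [e1] at hs
  rw [e2] at hu
  rw [hxy.pair_eq] at ht
  rw [hyz.pair_eq] at hs
  rw [hγ] at hu
  change _ = _ + (1 - t) • f.value z at ht
  change _ = s • f.value x + _ at hs
  change _ = _ + (1 - u) • f.value y at hu
  have hρ := hxy.pos
  have hσ := hyz.pos
  have hp : (1 + ρ)⁻¹ * (1 + ρ) = 1 := inv_mul_cancel₀ (by positivity)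
  have hq : (1 + σ)⁻¹ * (1 + σ) = 1 := inv_mul_cancel₀ (by positivity)
  have hp0 : (1 + ρ)⁻¹ ≠ 0 := by positivity
  generalize (1 + ρ)⁻¹ = p at *
  generalize (1 + σ)⁻¹ = q at *
  generalize f.value x = a at *
  generalize f.value y = b at *
  generalize f.value z = c at *
  obtain ⟨h1, h2, h3⟩ := coeff_eq_zero_of_not_collinear hcol
    (r := t * p - s) (s := t * p * ρ - (1 - s) * q) (t := 1 - t - (1 - s) * q * σ)
    (by linear_combination t * hp - (1 - s) * hq)
    (by rw [← sub_eq_zero.2 (ht.symm.trans hs)]; module)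
  obtain ⟨k1, k2, k3⟩ := coeff_eq_zero_of_not_collinear hcol
    (r := t * p - u * γ) (s := t * p * ρ - (1 - u)) (t := 1 - t - u * (1 - γ))
    (by linear_combination t * hp)
    (by rw [← sub_eq_zero.2 (ht.symm.trans hu)]; module)
  have hu0 : u ≠ 0 := by
    rintro rfl
    have ht0 : t = 0 := by
      have : t * p = 0 := by linear_combination k1
      exact (mul_eq_zero.1 this).resolve_right hp0
    rw [ht0] at k2
    norm_num at k2
  have hγ' : 1 - γ = ρ * σ * γ := by
    apply mul_left_cancel₀ hu0
    linear_combination h3 - k3 - σ * h2 + ρ * σ * k1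
  refine ⟨mul_pos hρ hσ, hvxz, ?_⟩
  have g1 : (1 + ρ * σ) * γ = 1 := by linear_combination -hγ'
  have g2 : (1 + ρ * σ) * (1 - γ) = ρ * σ := by linear_combination -g1
  rw [hγ, smul_add, smul_smul, smul_smul, g1, g2, one_smul]

end BalancedBy

variable {x y z u v : α} {ρ σ τ : ℝ}

theorem exists_balancedBy_of_pair_ne (hwa : f.WeightedAveraging) (h1 : f (pair x y) ≠ f.value x)
    (h2 : f (pair x y) ≠ f.value y) : ∃ ρ, f.BalancedBy x y ρ := by
  classical
  have hxy : x ≠ y := by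
    rintro rfl
    exact h1 (congrArg f (Subtype.ext (by simp [pair, union, single])))
  obtain ⟨t, ht0, ht1, ht⟩ := hwa (single x) (single y) (by simp [single, hxy])
  change f (pair x y) = t • f.value x + (1 - t) • f.value y at ht
  have ht0' : 0 < t := by
    refine ht0.lt_of_ne ?_
    rintro rfl
    exact h2 (by rw [ht]; module)
  have ht1' : t < 1 := by
    refine ht1.lt_of_ne ?_
    rintro rfl
    exact h1 (by rw [ht]; module)
  refine ⟨(1 - t) / t, div_pos (by linarith) ht0', fun h => h1 ?_, ?_⟩
  · rw [ht, h]; module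
  · rw [ht]
    match_scalars <;> field_simp <;> ring

/-- A partner of `y` whose output is off a given line through the output of `y`. -/
theorem exists_balancedBy_not_collinear (hrich : f.StronglyRich) (hwa : f.WeightedAveraging)
    (hxy : f.value x ≠ f.value y) :
    ∃ z τ, f.BalancedBy y z τ ∧ ¬ Collinear ℝ {f.value x, f.value y, f.value z} := by
  obtain ⟨a, b, hcol, ⟨ha1, ha2⟩, hb1, hb2⟩ := hrich y
  obtain ⟨σ, hσ⟩ := exists_balancedBy_of_pair_ne hwa ha1 ha2
  obtain ⟨τ, hτ⟩ := exists_balancedBy_of_pair_ne hwa hb1 hb2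
  -- If both partners were on the line, they would be collinear with `y`, against richness.
  by_contra! hcon
  have h1 := hcon a σ hσ
  have h2 := hcon b τ hτ
  refine hcol (collinear_triple_of_mem_affineSpan_pair (p₄ := f.value x) (p₅ := f.value y)
    (right_mem_affineSpan_pair ℝ _ _) ?_ ?_)
  · exact h1.mem_affineSpan_of_mem_of_ne (by simp) (by simp) (by simp) hxy
  · exact h2.mem_affineSpan_of_mem_of_ne (by simp) (by simp) (by simp) hxy

theorem BalancedBy.trans (hrich : f.StronglyRich) (hwa : f.WeightedAveraging)
    (hxy : f.BalancedBy x y ρ) (hyz : f.BalancedBy y z σ) (hxz : f.value x ≠ f.value z) :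
    f.BalancedBy x z (ρ * σ) := by
  by_cases hcol : Collinear ℝ {f.value x, f.value y, f.value z}
  swap
  · exact hxy.trans_of_not_collinear hwa hyz hcol
  -- Detour x, a, z through a partner `a` of `y` off the line; its ratio τ cancels.
  obtain ⟨a, τ, hya, hnc⟩ := exists_balancedBy_not_collinear hrich hwa hxy.value_ne
  have hz : f.value z ∈ line[ℝ, f.value x, f.value y] :=
    hcol.mem_affineSpan_of_mem_of_ne (by simp) (by simp) (by simp) hxy.value_ne
  have key : ∀ p q : H, p ∈ line[ℝ, f.value x, f.value y] →
      q ∈ line[ℝ, f.value x, f.value y] → p ≠ q → ¬ Collinear ℝ {p, q, f.value a} := by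
    intro p q hp hq hpq hc
    have ha : f.value a ∈ line[ℝ, p, q] :=
      hc.mem_affineSpan_of_mem_of_ne (by simp) (by simp) (by simp) hpq
    have hle : line[ℝ, p, q] ≤ line[ℝ, f.value x, f.value y] := affineSpan_pair_le_of_mem_of_mem hp hq
    exact hnc (collinear_triple_of_mem_affineSpan_pair (left_mem_affineSpan_pair ℝ _ _)
      (right_mem_affineSpan_pair ℝ _ _) (hle ha))
  have hxm := left_mem_affineSpan_pair ℝ (f.value x) (f.value y)
  have hym := right_mem_affineSpan_pair ℝ (f.value x) (f.value y)
  have hxa := hxy.trans_of_not_collinear hwa hya hnc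
  have haz := hya.symm.trans_of_not_collinear hwa hyz (by
    have h := key _ _ hym hz hyz.value_ne
    rwa [Set.pair_comm, Set.insert_comm] at h)
  have h := hxa.trans_of_not_collinear hwa haz (by
    have h := key _ _ hxm hz hxz
    rwa [Set.pair_comm] at h)
  have hτ := hya.pos.ne'
  convert h using 1
  field_simp

/-- Since `x` and `u` have equal outputs they form no balanced pair, so the chain cannot be
shortened there. If `y` and `v` also have equal outputs, a partner of `y` with a third output serves
as intermediate. -/
theorem BalancedBy.trans₃ (hrich : f.StronglyRich) (hwa : f.WeightedAveraging)
    (hxy : f.BalancedBy x y ρ) (hyu : f.BalancedBy y u σ) (huv : f.BalancedBy u v τ)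
    (hxu : f.value x = f.value u) : f.BalancedBy x v (ρ * σ * τ) := by
  have hxv : f.value x ≠ f.value v := hxu ▸ huv.value_ne
  by_cases hyv : f.value y = f.value v
  swap
  · rw [mul_assoc]
    exact hxy.trans hrich hwa (hyu.trans hrich hwa huv hyv) hxv
  obtain ⟨a, κ, hya, hnc⟩ := exists_balancedBy_not_collinear hrich hwa hxy.value_ne
  have hax : f.value x ≠ f.value a := by
    intro h
    apply hnc
    rw [← h, Set.pair_comm, ← Set.insert_comm, Set.pair_comm, Set.insert_comm]
    simpa using collinear_pair ℝ (f.value y) (f.value x)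
  have hxa := hxy.trans hrich hwa hya hax
  have hau := hya.symm.trans hrich hwa hyu (hxu ▸ hax.symm)
  have hav := hau.trans hrich hwa huv (hyv ▸ hya.value_ne.symm)
  have h := hxa.trans hrich hwa hav hxv
  have hκ := hya.pos.ne'
  convert h using 1
  field_simp

/-- `x` and `u` are joined by a chain of balanced pairs whose ratios multiply to the given
number. -/
inductive Linked (f : AggregationRule α H) (x : α) : α → ℝ → Prop
  | refl : Linked f x x 1
  | tail {u v : α} {ρ σ : ℝ} : Linked f x u ρ → f.BalancedBy u v σ → Linked f x v (ρ * σ)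

namespace Linked

theorem pos (h : f.Linked x u ρ) : 0 < ρ := by
  induction h with
  | refl => exact one_pos
  | tail _ h ih => exact mul_pos ih h.pos

theorem trans (h : f.Linked x y ρ) (h' : f.Linked y z σ) : f.Linked x z (ρ * σ) := by
  induction h' with
  | refl => rwa [mul_one]
  | tail _ hb ih => rw [← mul_assoc]; exact ih.tail hb

theorem of_balancedBy (h : f.BalancedBy x y ρ) : f.Linked x y ρ := by
  simpa using Linked.refl.tail h

theorem symm (h : f.Linked x u ρ) : f.Linked u x ρ⁻¹ := by
  induction h with
  | refl => simpa using Linked.refl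
  | tail _ hb ih => rw [mul_inv, mul_comm]; exact (of_balancedBy hb.symm).trans ih

/-- Chains shorten to one step, or to two when the end outputs coincide, where no single step is
possible. -/
theorem balancedBy_or (hrich : f.StronglyRich) (hwa : f.WeightedAveraging)
    (h : f.Linked x u ρ) : f.BalancedBy x u ρ ∨
      f.value x = f.value u ∧ ∃ y σ τ, f.BalancedBy x y σ ∧ f.BalancedBy y u τ ∧ σ * τ = ρ := by
  induction h with
  | refl =>
    obtain ⟨y, -, -, ⟨h1, h2⟩, -⟩ := hrich x
    obtain ⟨σ, hσ⟩ := exists_balancedBy_of_pair_ne hwa h1 h2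
    exact Or.inr ⟨rfl, y, σ, σ⁻¹, hσ, hσ.symm, mul_inv_cancel₀ hσ.pos.ne'⟩
  | @tail u v ρ κ _ hb ih =>
    rcases ih with ih | ⟨hxu, y, σ, τ, hσ, hτ, rfl⟩
    · by_cases hxv : f.value x = f.value v
      · exact Or.inr ⟨hxv, u, _, _, ih, hb, rfl⟩
      · exact Or.inl (ih.trans hrich hwa hb hxv)
    · exact Or.inl (hσ.trans₃ hrich hwa hτ hb hxu)

theorem balancedBy (hrich : f.StronglyRich) (hwa : f.WeightedAveraging)
    (h : f.Linked x u ρ) (hne : f.value x ≠ f.value u) : f.BalancedBy x u ρ :=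
  (h.balancedBy_or hrich hwa).resolve_right fun h' => hne h'.1

end Linked

theorem average_eq_centerMass (w : α → ℝ) (B : Finset α) :
    f.average w B = B.centerMass w f.value := by
  simp only [average, Finset.centerMass, Finset.smul_sum, smul_smul, div_eq_inv_mul]

theorem eq_average_of_balancedBy (hrich : f.StronglyRich) (hwa : f.WeightedAveraging)
    [Nonempty α] {w : α → ℝ} (hw : ∀ x, 0 < w x)
    (h : ∀ x y, f.value x ≠ f.value y → f.BalancedBy x y (w y / w x)) (A : NonemptyFinset α) :
    f A = f.average w A.1 := by
  classical
  -- The value 0 on the empty set is never used.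
  let F : Finset α → H := fun B => if hB : B.Nonempty then f ⟨B, hB⟩ else 0
  have hF : ∀ B : NonemptyFinset α, F B.1 = f B := fun B => dif_pos B.2
  have hFv : (fun a => F {a}) = f.value := funext fun a => hF (single a)
  have hun : ∀ B C : NonemptyFinset α, (union B C).1 = B.1 ∪ C.1 := fun B C => by
    ext a; simp [union]
  have hfpair : ∀ x y : α, F {x, y} = f (pair x y) := by
    intro x y
    rw [← hF (pair x y), pair, hun]
    rfl
  have hFwa : ∀ B C : Finset α, B.Nonempty → C.Nonempty → Disjoint B C →
      ∃ t : ℝ, F (B ∪ C) = t • F B + (1 - t) • F C := by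
    intro B C hB hC hBC
    obtain ⟨t, -, -, ht⟩ := hwa ⟨B, hB⟩ ⟨C, hC⟩ hBC
    refine ⟨t, ?_⟩
    rw [← hF, ← hF, ← hF, hun] at ht
    exact ht
  rw [average_eq_centerMass, ← hF A, ← hFv]
  refine eq_centerMass_of_pairs hw hFwa ?_ ?_ A.1 A.2
  · intro x y hxy
    rw [hFv, hfpair, Finset.centerMass_pair (hne := hxy)]
    have hx := hw x
    have hy := hw y
    by_cases hv : f.value x = f.value y
    -- With equal outputs every average is the common value, so the weights do not matter.
    · obtain ⟨t, -, -, ht⟩ := hwa (single x) (single y) (by simp [single, hxy])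
      change f (pair x y) = t • f.value x + (1 - t) • f.value y at ht
      rw [ht, hv]
      match_scalars
      field_simp
      ring
    · rw [(h x y hv).pair_eq]
      match_scalars <;> field_simp
  · rw [hFv]
    intro hc
    obtain ⟨x⟩ := ‹Nonempty α›
    obtain ⟨y, z, hnc, -⟩ := hrich x
    refine hnc (hc.subset ?_)
    rintro _ (rfl | rfl | rfl) <;> exact Set.mem_range_self _

/-- If `y` were strictly above `x`, the pair's output would be that of `y`, which balance excludes.
-/
theorem RepresentedBy.rel_of_balancedBy {r : α → α → Prop} {w : α → ℝ}
    (h : f.RepresentedBy r w) (hxy : f.BalancedBy x y ρ) : r x y := by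
  classical
  obtain ⟨hr, hw, hf⟩ := h
  by_contra hn
  have hyx : r y x := (hr.complete x y).resolve_left hn
  have hhigh : highest r (pair x y).1 = {y} := by
    ext a
    simp only [highest, pair, union, single, Finset.mem_filter, Finset.mem_union,
      Finset.mem_singleton, forall_eq_or_imp, forall_eq]
    constructor
    · rintro ⟨rfl | rfl, h1⟩
      · exact absurd h1.2 hn
      · rfl
    · rintro rfl
      exact ⟨Or.inr rfl, hyx, hr.refl _⟩
  apply hxy.pair_ne_right
  rw [hf, hhigh, average, Finset.sum_singleton, Finset.sum_singleton, div_self (hw y).ne', one_smul]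

theorem RepresentedBy.rel_of_linked {r : α → α → Prop} {w : α → ℝ}
    (h : f.RepresentedBy r w) (hxu : f.Linked x u ρ) : r x u := by
  induction hxu with
  | refl => exact h.1.refl x
  | tail _ hb ih => exact h.1.trans _ _ _ ih (h.rel_of_balancedBy hb)

end Balance

/-! ### Connectedness and continuity of the weight. -/

section Continuity

variable {α H : Type*} [NormedAddCommGroup H] {f : AggregationRule α H}

theorem BalancedBy.ratio_eq [NormedSpace ℝ H] {x y : α} {ρ : ℝ} (h : f.BalancedBy x y ρ) :
    ρ = ‖f (pair x y) - f.value x‖ / ‖f (pair x y) - f.value y‖ := by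
  have hρ := h.pos
  have hne : ‖f (pair x y) - f.value y‖ ≠ 0 := norm_ne_zero_iff.2 (sub_ne_zero.2 h.pair_ne_right)
  have heq : f (pair x y) - f.value x = -(ρ • (f (pair x y) - f.value y)) := by
    have h1 := h.2.2
    rw [add_smul, one_smul] at h1
    rw [← sub_eq_zero] at h1 ⊢
    rw [← h1]
    module
  rw [eq_div_iff hne, heq, norm_neg, norm_smul, Real.norm_of_nonneg hρ.le]

variable [TopologicalSpace α] [FirstCountableTopology α]

theorem ContinuousRule.continuous_value (hcont : f.ContinuousRule) : Continuous f.value := by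
  classical
  rw [continuous_iff_continuousAt]
  intro x
  refine tendsto_of_seq_tendsto fun u hu => ?_
  have h := hcont ∅ x (by simp) u hu
  exact h

theorem ContinuousRule.continuousAt_pair (hcont : f.ContinuousRule) {x y : α} (hxy : x ≠ y) :
    ContinuousAt (fun y' => f (pair x y')) y := by
  classical
  have hp : ∀ y', pair x y' = insertPoint {x} y' := fun y' => by
    apply Subtype.ext
    ext a
    simp [pair, union, single, insertPoint, or_comm]
  refine tendsto_of_seq_tendsto fun u hu => ?_
  have h := hcont {x} y (by simpa using hxy.symm) u hu
  simpa only [hp, Function.comp_def] using h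

variable [NormedSpace ℝ H]

theorem eventually_exists_balancedBy (hcont : f.ContinuousRule) (hwa : f.WeightedAveraging)
    {x y : α} {ρ : ℝ} (hxy : f.BalancedBy x y ρ) : ∀ᶠ y' in 𝓝 y, ∃ σ, f.BalancedBy x y' σ := by
  have hne : x ≠ y := fun h => hxy.value_ne (h ▸ rfl)
  have hc := hcont.continuousAt_pair hne
  have hsub := (hc.sub hcont.continuous_value.continuousAt).eventually_ne
    (sub_ne_zero.2 hxy.pair_ne_right)
  filter_upwards [hc.eventually_ne hxy.pair_ne_left, hsub] with y' h1 h2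
  rw [Pi.sub_apply, sub_ne_zero] at h2
  exact exists_balancedBy_of_pair_ne hwa h1 h2

/-- Each point is linked to its neighbours through a common partner, so the points linked to `x`
form a nonempty clopen set. -/
theorem exists_linked [PreconnectedSpace α] (hrich : f.StronglyRich) (hcont : f.ContinuousRule)
    (hwa : f.WeightedAveraging) (x u : α) : ∃ ρ, f.Linked x u ρ := by
  have hloc : ∀ u : α, ∀ᶠ u' in 𝓝 u, ∃ κ, f.Linked u u' κ := by
    intro u
    obtain ⟨z, -, -, ⟨h1, h2⟩, -⟩ := hrich u
    obtain ⟨σ, hσ⟩ := exists_balancedBy_of_pair_ne hwa h1 h2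
    filter_upwards [eventually_exists_balancedBy hcont hwa hσ.symm] with u' hu'
    obtain ⟨τ, hτ⟩ := hu'
    exact ⟨σ * τ, (Linked.of_balancedBy hσ).tail hτ⟩
  have hclopen : IsClopen {u | ∃ ρ, f.Linked x u ρ} := by
    constructor
    · rw [← isOpen_compl_iff, isOpen_iff_mem_nhds]
      intro u hu
      filter_upwards [hloc u] with u' hu' hx
      obtain ⟨κ, hκ⟩ := hu'
      obtain ⟨ρ, hρ⟩ := hx
      exact hu ⟨_, hρ.trans hκ.symm⟩
    · rw [isOpen_iff_mem_nhds]
      rintro u ⟨ρ, hρ⟩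
      filter_upwards [hloc u] with u' hu'
      obtain ⟨κ, hκ⟩ := hu'
      exact ⟨_, hρ.trans hκ⟩
  have huniv := hclopen.eq_univ ⟨x, 1, Linked.refl⟩
  exact huniv.ge (Set.mem_univ u)

theorem continuous_of_balancedBy (hrich : f.StronglyRich) (hcont : f.ContinuousRule)
    {w : α → ℝ} (hw : ∀ x, 0 < w x)
    (h : ∀ x y, f.value x ≠ f.value y → f.BalancedBy x y (w y / w x)) : Continuous w := by
  rw [continuous_iff_continuousAt]
  intro y
  have hval := hcont.continuous_value.continuousAt (x := y)
  obtain ⟨x, hx⟩ : ∃ x, f.value x ≠ f.value y := by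
    by_contra! hcon
    obtain ⟨a, b, hcol, -⟩ := hrich y
    refine hcol ?_
    rw [hcon a, hcon b]
    simpa using collinear_singleton ℝ (f.value y)
  have hxy : x ≠ y := fun h => hx (h ▸ rfl)
  have hpair := hcont.continuousAt_pair hxy
  -- Near `y`, `w` is `w x` times the norm quotient of `ratio_eq`, for a fixed `x` with a different
  -- output.
  have hlim : ContinuousAt (fun y' => w x * (‖f (pair x y') - f.value x‖ /
      ‖f (pair x y') - f.value y'‖)) y :=
    continuousAt_const.mul ((hpair.sub continuousAt_const).norm.div (hpair.sub hval).norm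
      (norm_ne_zero_iff.2 (sub_ne_zero.2 (h x y hx).pair_ne_right)))
  refine hlim.congr ?_
  filter_upwards [hval.eventually_ne hx.symm] with y' hy'
  rw [← (h x y' hy'.symm).ratio_eq, mul_div_cancel₀ _ (hw x).ne']

end Continuity

end AggregationRule

open AggregationRule in
theorem theorem4 {E H : Type*} [NormedAddCommGroup E] [NormedSpace ℝ E]
    [NormedAddCommGroup H] [NormedSpace ℝ H]
    (X : Set E) (hX : Convex ℝ X)
    (f : AggregationRule X H)
    (hrich : f.StronglyRich) (hcont : f.ContinuousRule) (hwa : f.WeightedAveraging) :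
    (∃ w : X → ℝ, Continuous w ∧ (∀ x, 0 < w x) ∧
      ∀ A : NonemptyFinset X, f A = f.average w A.1) ∧
    (∀ (r : X → X → Prop) (v : X → ℝ), f.RepresentedBy r v → ∀ x y : X, r x y) := by
  have : PreconnectedSpace X := Subtype.preconnectedSpace hX.isPreconnected
  have hlink := exists_linked hrich hcont hwa
  refine ⟨?_, fun r v hr x y => ?_⟩
  · rcases isEmpty_or_nonempty X with hE | ⟨⟨x₀⟩⟩
    · exact ⟨fun _ => 1, continuous_const, fun _ => one_pos,
        fun A => isEmptyElim A.2.choose⟩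
    -- Any choice of chains works: going back to `x₀` and out again is a chain from `x` to `y` with
    -- product `w y / w x`.
    · choose w hw using hlink x₀
      have hpos : ∀ x, 0 < w x := fun x => (hw x).pos
      have hbal : ∀ x y, f.value x ≠ f.value y → f.BalancedBy x y (w y / w x) := by
        intro x y hxy
        have h := ((hw x).symm.trans (hw y)).balancedBy hrich hwa hxy
        rwa [← div_eq_inv_mul] at h
      have : Nonempty X := ⟨x₀⟩
      exact ⟨w, continuous_of_balancedBy hrich hcont hpos hbal, hpos,
        eq_average_of_balancedBy hrich hwa hpos hbal⟩
  · obtain ⟨ρ, hρ⟩ := hlink x y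
    exact hr.rel_of_linked hρ
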